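/- Let $M$ be a closed (compact, without boundary) connected Riemannian manifold of dimension $n$, let $\rho$ be a representation of $\pi_1(M)$ by linear isometries on a real inner product space $V$, and let $E(\rho)=\widetilde M\times_\rho V$ be the associated flat bundle. For $0\le k\le n$ let $\Omega^k$ be the space of smooth $E(\rho)$-valued $k$-forms with its $L^2$ inner product $\langle\,,\rangle$, let $d_k:\Omega^k\to\Omega^{k+1}$ be the exterior differential coupled to the flat connection, and let $\Omega'_k=\operatorname{Im} d_{k-1}\subset\Omega^k$ be the exact part ($\Omega_0'=0$). Assume that the complex $(\Omega^\bullet,d_\bullet)$ is acyclic. Let $\mathcal H_k$ be the $L^2$ completion of $\Omega^k$, let $\mathcal H'_k$ be the closure of $\Omega'_k$ in $\mathcal H_k$, and let $\xi\mapsto\xi'$ be the orthogonal projection $\mathcal H_k\to\mathcal H_k'$. Gaussian measures are carried by Hilbert–Schmidt extensions. A Hilbert–Schmidt extension of a Hilbert space $\mathcal H$ is a Hilbert space $K$ with an injective Hilbert–Schmidt operator $J:\mathcal H\to K$ of dense range. The test vectors are the $\xi=J^*y\in\mathcal H$ with $y\in K$; they are paired with $\varphi\in K$ by $\langle\xi,\varphi\rangle:=\langle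 y,\varphi\rangle_K$. The Gaussian measure with characteristic function $\exp(-\frac c2\langle\xi,\xi\rangle)$ is the Borel probability measure $\mu$ on $K$ with $\widehat\mu(\xi):=\int_K e^{i\langle\xi,\varphi\rangle}\,d\mu(\varphi)=\exp(-\frac c2\langle\xi,\xi\rangle_{\mathcal H})$ for all test vectors $\xi$. Let $K$ and $K'$ be Hilbert–Schmidt extensions of $\mathcal H_k$ and $\mathcal H_k'$ such that the projection $\xi\mapsto\xi'$ extends to a continuous linear map $K\to K'$, written $\alpha\mapsto\alpha'$. Let $a,b>0$, let $\mu_a$ be the Gaussian measure on $K$ with characteristic function $\exp(-\frac a2\langle\alpha,\alpha\rangle)$, and let $\mu'_b$ be the Gaussian measure on $K'$ with characteristic function $\exp(-\frac b2\langle\eta,\eta\rangle)$. Write $\widehat\mu'_a$ for the restriction of $\widehat\mu_a$ to the test vectors of $\mathcal H'_k$, that is, $\widehat\mu_a'(\xi)=\int_K e^{i\langle\xi,\alpha'\rangle}\,d\mu_a(\alpha)$. For a finite-dimensional space $S$ of test vectors of $\mathcal H_k'$ and $\eta\in K'$, let $P_S\eta\in S$ be the vector with $\langle\xi,P_S\eta\rangle_{\mathcal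 H'_k}=\langle\xi,\eta\rangle$ for all $\xi\in S$. Then: 1. For every such $S$, $$\int_{K'}\widehat\mu'_a(P_S\eta)\,d\mu'_b(\eta)=\int_{K}\widehat\mu'_b(P_S\alpha')\,d\mu_a(\alpha),$$ both integrands being integrable. 2. For every $\eta\in K'$ the limits $\widehat\mu'_a(\eta):=\lim_S\widehat\mu'_a(P_S\eta)$ and $\widehat\mu'_b(\eta):=\lim_S\widehat\mu'_b(P_S\eta)$ exist, along the finite-dimensional spaces $S$ of test vectors of $\mathcal H_k'$ directed by inclusion. With these extensions of the characteristic functions to $K'$, the functions $\eta\mapsto\widehat\mu_a'(\eta)$ and $\alpha\mapsto\widehat\mu_b'(\alpha')$ are integrable with respect to $\mu'_b$ and $\mu_a$, and $$\int_{K'}\widehat\mu'_a(\eta)\,d\mu'_b(\eta)=\int_{K}\widehat\mu'_b(\alpha')\,d\mu_a(\alpha).$$ -/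

import Mathlib

open Set Filter Topology MeasureTheory Bundle Manifold
open scoped ContDiff Bundle Manifold ENNReal

noncomputable section

namespace TwistedForms

section Pointwise

variable {T V : Type*} [NormedAddCommGroup T] [InnerProductSpace ℝ T] [FiniteDimensional ℝ T]
  [NormedAddCommGroup V] [InnerProductSpace ℝ V] {k : ℕ}

/-- The inner product on `Λᵏ T* ⊗ V` induced by the inner products of `T` and `V`. With `e` an
orthonormal basis of `T`, it is `∑_{i₁ < ⋯ < iₖ} ⟪A(e_{i₁},…,e_{iₖ}), B(e_{i₁},…,e_{iₖ})⟫`,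
written here as `1/k!` times the sum over all multi-indices. -/
def altInner (A B : T [⋀^Fin k]→L[ℝ] V) : ℝ :=
  ((k.factorial : ℝ))⁻¹ * ∑ i : Fin k → Fin (Module.finrank ℝ T),
    inner ℝ (A fun l => stdOrthonormalBasis ℝ T (i l)) (B fun l => stdOrthonormalBasis ℝ T (i l))

/-- The same inner product in an arbitrary basis, through the inverse Gram matrix. -/
theorem altInner_eq_gram {ι : Type*} [Fintype ι] [DecidableEq ι] (f : Module.Basis ι ℝ T)
    (A B : T [⋀^Fin k]→L[ℝ] V) :
    altInner A B = ((k.factorial : ℝ))⁻¹ * ∑ p : Fin k → ι, ∑ q : Fin k → ι,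
      (∏ l, (Matrix.of fun i j => inner ℝ (f i) (f j))⁻¹ (p l) (q l)) *
        inner ℝ (A fun l => f (p l)) (B fun l => f (q l)) := by
  set e := stdOrthonormalBasis ℝ T with he
  set C : Matrix (Fin (Module.finrank ℝ T)) ι ℝ := Matrix.of fun i p => f.repr (e i) p with hC
  set D : Matrix ι (Fin (Module.finrank ℝ T)) ℝ := Matrix.of fun p j => inner ℝ (e j) (f p) with hD
  have hCD : C * D = 1 := by
    ext i j
    have h1 : inner ℝ (e j) (e i) = ∑ p, f.repr (e i) p * inner ℝ (e j) (f p) := by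
      conv_lhs => rw [← f.sum_repr (e i)]
      rw [inner_sum]
      simp [inner_smul_right]
    rw [Matrix.mul_apply]
    simp only [hC, hD, Matrix.of_apply]
    rw [← h1, e.inner_eq_ite, Matrix.one_apply]
    simp [eq_comm]
  have hDC : D * C = 1 := by
    ext p q
    have h1 : f.repr (f p) q = ∑ j, inner ℝ (e j) (f p) * f.repr (e j) q := by
      conv_lhs => rw [← e.sum_repr' (f p)]
      simp
    rw [Matrix.mul_apply]
    simp only [hC, hD, Matrix.of_apply]
    rw [← h1, f.repr_self, Matrix.one_apply, Finsupp.single_apply]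
  have hG : (Matrix.of fun i j => inner ℝ (f i) (f j)) = D * D.transpose := by
    ext p q
    rw [Matrix.mul_apply]
    simp only [hD, Matrix.of_apply, Matrix.transpose_apply]
    rw [← e.sum_inner_mul_inner (f p) (f q)]
    exact Finset.sum_congr rfl fun j _ => by rw [real_inner_comm]
  have hinv : (Matrix.of fun i j => inner ℝ (f i) (f j))⁻¹ = C.transpose * C := by
    apply Matrix.inv_eq_right_inv
    rw [hG, Matrix.mul_assoc, ← Matrix.mul_assoc D.transpose, ← Matrix.transpose_mul, hCD,
      Matrix.transpose_one, Matrix.one_mul, hDC]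
  have hexp : ∀ (A : T [⋀^Fin k]→L[ℝ] V) (i : Fin k → Fin (Module.finrank ℝ T)),
      (A fun l => e (i l)) = ∑ p : Fin k → ι, (∏ l, C (i l) (p l)) • A fun l => f (p l) := by
    intro A i
    have h1 : (fun l => e (i l)) = fun l => ∑ p, C (i l) p • f p := by
      funext l
      exact (f.sum_repr (e (i l))).symm
    rw [h1]
    change A.toMultilinearMap (fun l => ∑ p, C (i l) p • f p) = _
    rw [MultilinearMap.map_sum]
    refine Finset.sum_congr rfl fun p _ => ?_
    rw [MultilinearMap.map_smul_univ]
    rfl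
  rw [altInner, hinv]
  congr 1
  simp only [← he, hexp, sum_inner, inner_sum, real_inner_smul_left, real_inner_smul_right]
  conv_rhs => rw [Finset.sum_comm]
  rw [Finset.sum_comm]
  refine Finset.sum_congr rfl fun q _ => ?_
  rw [Finset.sum_comm]
  refine Finset.sum_congr rfl fun p _ => ?_
  simp only [← mul_assoc, ← Finset.sum_mul]
  congr 1
  simp only [← Finset.prod_mul_distrib, Matrix.mul_apply, Matrix.transpose_apply]
  rw [Finset.prod_univ_sum, Fintype.piFinset_univ]
  exact Finset.sum_congr rfl fun x _ => Finset.prod_congr rfl fun _ _ => mul_comm _ _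

theorem altInner_comm (A B : T [⋀^Fin k]→L[ℝ] V) : altInner A B = altInner B A := by
  simp [altInner, real_inner_comm]

theorem altInner_add_left (A A' B : T [⋀^Fin k]→L[ℝ] V) :
    altInner (A + A') B = altInner A B + altInner A' B := by
  simp [altInner, inner_add_left, Finset.sum_add_distrib, mul_add]

theorem altInner_smul_left (r : ℝ) (A B : T [⋀^Fin k]→L[ℝ] V) :
    altInner (r • A) B = r * altInner A B := by
  simp only [altInner, ContinuousAlternatingMap.smul_apply, real_inner_smul_left,
    ← Finset.mul_sum]
  ring

theorem altInner_self_nonneg (A : T [⋀^Fin k]→L[ℝ] V) : 0 ≤ altInner A A :=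
  mul_nonneg (by positivity) (Finset.sum_nonneg fun _ _ => real_inner_self_nonneg)

end Pointwise

section Manifold

variable {n : ℕ} {M : Type*} [TopologicalSpace M] 
  [ChartedSpace (EuclideanSpace ℝ (Fin n)) M] 
  {V : Type*} [NormedAddCommGroup V] [InnerProductSpace ℝ V] {x₀ : M}

variable (n V) in
/-- Arbitrary (not yet equivariant, not yet smooth) families `α x c` indexed by a point `x` and a
homotopy class `c` of paths from the base point `x₀` to `x`, with values in the alternating
`k`-forms on the tangent space at `x` with values in `V`. The classes `c` are the points of the
universal cover of `M` over `x`. -/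
def RawForm (x₀ : M) (k : ℕ) : Type _ :=
  ∀ x : M, Path.Homotopic.Quotient x₀ x → TangentSpace (𝓡 n) x [⋀^Fin k]→L[ℝ] V

instance (k : ℕ) : AddCommGroup (RawForm n V x₀ k) :=
  inferInstanceAs (AddCommGroup (∀ x : M, Path.Homotopic.Quotient x₀ x →
    TangentSpace (𝓡 n) x [⋀^Fin k]→L[ℝ] V))

instance (k : ℕ) : Module ℝ (RawForm n V x₀ k) :=
  inferInstanceAs (Module ℝ (∀ x : M, Path.Homotopic.Quotient x₀ x →
    TangentSpace (𝓡 n) x [⋀^Fin k]→L[ℝ] V))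

/-- The path in `M` from `x` to `φ⁻¹ u` which is a straight segment in the chart `φ` at `x`. -/
def chartRay (x : M) (u : EuclideanSpace ℝ (Fin n))
    (hu : segment ℝ (extChartAt (𝓡 n) x x) u ⊆ (extChartAt (𝓡 n) x).target) :
    Path x ((extChartAt (𝓡 n) x).symm u) where
  toFun t := (extChartAt (𝓡 n) x).symm (AffineMap.lineMap (extChartAt (𝓡 n) x x) u (t : ℝ))
  continuous_toFun := by
    apply (continuousOn_extChartAt_symm x).comp_continuous
    · exact AffineMap.lineMap_continuous.comp continuous_subtype_val
    · intro t
      apply hu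
      rw [segment_eq_image_lineMap]
      exact ⟨t, t.2, rfl⟩
  source' := by simp
  target' := by simp

open Classical in
/-- The `V`-valued form on a neighbourhood of `φ x` in `ℝⁿ` that represents `α` near `x`, where `φ`
is the chart at `x`: the pull-back of `α` by `φ⁻¹`, read in the flat local trivialization in which
the class `c` of paths to `x` is continued to the class of `c` followed by the chart segment from
`x` to `φ⁻¹ u`. -/
def localRep {k : ℕ} (α : RawForm n V x₀ k) (x : M) (c : Path.Homotopic.Quotient x₀ x)
    (u : EuclideanSpace ℝ (Fin n)) : EuclideanSpace ℝ (Fin n) [⋀^Fin k]→L[ℝ] V :=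
  if hu : segment ℝ (extChartAt (𝓡 n) x x) u ⊆ (extChartAt (𝓡 n) x).target then
    (α _ (c.trans (.mk (chartRay x u hu)))).compContinuousLinearMap
      (mfderiv 𝓘(ℝ, EuclideanSpace ℝ (Fin n)) (𝓡 n) (extChartAt (𝓡 n) x).symm u)
  else 0

/-- The exterior derivative coupled to the flat connection: at `x` it is the ordinary exterior
derivative of the local representative of `α` in the chart at `x` and in the flat local
trivialization around `x`. -/
def extD {k : ℕ} (α : RawForm n V x₀ k) : RawForm n V x₀ (k + 1) := fun x c =>
  (extDeriv (localRep α x c) (extChartAt (𝓡 n) x x)).compContinuousLinearMap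
    (mfderiv (𝓡 n) 𝓘(ℝ, EuclideanSpace ℝ (Fin n)) (extChartAt (𝓡 n) x) x)

theorem localRep_add {k : ℕ} (α β : RawForm n V x₀ k) (x : M) (c) :
    localRep (α + β) x c = localRep α x c + localRep β x c := by
  ext u v
  by_cases hu : segment ℝ (extChartAt (𝓡 n) x x) u ⊆ (extChartAt (𝓡 n) x).target
  · simp only [localRep, hu, dif_pos, Pi.add_apply]; rfl
  · simp only [localRep, dif_neg hu, Pi.add_apply]; simp

theorem localRep_smul {k : ℕ} (r : ℝ) (α : RawForm n V x₀ k) (x : M) (c) :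
    localRep (r • α) x c = r • localRep α x c := by
  ext u v
  by_cases hu : segment ℝ (extChartAt (𝓡 n) x x) u ⊆ (extChartAt (𝓡 n) x).target
  · simp only [localRep, hu, dif_pos, Pi.smul_apply]; rfl
  · simp only [localRep, dif_neg hu, Pi.smul_apply]; simp

variable (n) in
/-- The smooth `k`-forms on `M` with values in the flat bundle `E(ρ) = M̃ ×_ρ V`. A point of the
universal cover `M̃` over `x` is a homotopy class `c` of paths from `x₀` to `x`, on which a loop `γ`
acts by `c ↦ γ · c` (first `γ`, then `c`), and an element of the fibre `E(ρ)_x` is a function `f` of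
`c` with `f (γ · c) = ρ(γ)⁻¹ f c`. The product of the fundamental group in Mathlib is the reversed
concatenation, so that this is compatible with concatenation of loops. As `ρ` acts by isometries,
the inner product of `V` is an inner product on `E(ρ)`. -/
def smoothForms (ρ : FundamentalGroup M x₀ →* (V ≃ₗᵢ[ℝ] V)) (k : ℕ) :
    Submodule ℝ (RawForm n V x₀ k) where
  carrier := {α | (∀ (x : M) (γ : FundamentalGroup M x₀) (c : Path.Homotopic.Quotient x₀ x) v,
      α x (γ.toPath.trans c) v = ρ γ⁻¹ (α x c v)) ∧
    ∀ (x : M) (c : Path.Homotopic.Quotient x₀ x),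
      ContDiffAt ℝ ∞ (localRep α x c) (extChartAt (𝓡 n) x x)}
  zero_mem' := by
    refine ⟨fun x γ c v => by simp [show (0 : RawForm n V x₀ k) x = 0 from rfl], fun x c => ?_⟩
    have : localRep (0 : RawForm n V x₀ k) x c = 0 := by
      simpa using localRep_smul 0 (0 : RawForm n V x₀ k) x c
    rw [this]; exact contDiffAt_const
  add_mem' := by
    rintro α β ⟨h1, h2⟩ ⟨h3, h4⟩
    refine ⟨fun x γ c v => ?_, fun x c => ?_⟩
    · change α x _ v + β x _ v = ρ γ⁻¹ (α x c v + β x c v)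
      rw [h1, h3, map_add]
    · rw [localRep_add]; exact (h2 x c).add (h4 x c)
  smul_mem' := by
    rintro r α ⟨h1, h2⟩
    refine ⟨fun x γ c v => ?_, fun x c => ?_⟩
    · change r • α x _ v = ρ γ⁻¹ (r • α x c v)
      rw [h1, map_smul]
    · rw [localRep_smul]; exact contDiffAt_const.smul (h2 x c)

section Riemannian

variable [RiemannianBundle (fun x : M => TangentSpace (𝓡 n) x)]

instance (x : M) : FiniteDimensional ℝ (TangentSpace (𝓡 n) x) :=
  inferInstanceAs (FiniteDimensional ℝ (EuclideanSpace ℝ (Fin n)))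

/-- The pointwise inner product of two forms at `x`; for forms with values in `E(ρ)` it can be
computed with any class of paths (see `pairing_eq`). -/
def pairing [PathConnectedSpace M] {k : ℕ} (α β : RawForm n V x₀ k) (x : M) : ℝ :=
  altInner (α x (.mk (PathConnectedSpace.somePath x₀ x)))
    (β x (.mk (PathConnectedSpace.somePath x₀ x)))

theorem pairing_eq [PathConnectedSpace M] {ρ : FundamentalGroup M x₀ →* (V ≃ₗᵢ[ℝ] V)} {k : ℕ}
    {α β : RawForm n V x₀ k} (hα : α ∈ smoothForms n ρ k) (hβ : β ∈ smoothForms n ρ k) (x : M)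
    (c : Path.Homotopic.Quotient x₀ x) : pairing α β x = altInner (α x c) (β x c) := by
  set c' : Path.Homotopic.Quotient x₀ x := .mk (PathConnectedSpace.somePath x₀ x) with hc'
  have h : ∃ γ : FundamentalGroup M x₀, γ.toPath.trans c = c' := by
    refine ⟨FundamentalGroup.fromPath (c'.trans c.symm), ?_⟩
    let f : FundamentalGroupoid.mk x₀ ⟶ FundamentalGroupoid.mk x := c
    let g : FundamentalGroupoid.mk x₀ ⟶ FundamentalGroupoid.mk x := c'
    have h1 : (CategoryTheory.CategoryStruct.comp
        (CategoryTheory.CategoryStruct.comp g (CategoryTheory.Groupoid.inv f)) f) = g := by simp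
    exact h1
  obtain ⟨γ, hγ⟩ := h
  rw [pairing, ← hc', ← hγ]
  simp only [altInner]
  congr 1
  refine Finset.sum_congr rfl fun i _ => ?_
  rw [hα.1, hβ.1, LinearIsometryEquiv.inner_map_map]

/-- The matrix `g_{ij}` of the Riemannian metric at the point with coordinates `u` in the chart
at `x`. -/
def gram (x : M) (u : EuclideanSpace ℝ (Fin n)) : Matrix (Fin n) (Fin n) ℝ :=
  Matrix.of fun i j => inner ℝ
    (mfderiv 𝓘(ℝ, EuclideanSpace ℝ (Fin n)) (𝓡 n) (extChartAt (𝓡 n) x).symm u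
      (EuclideanSpace.single i 1))
    (mfderiv 𝓘(ℝ, EuclideanSpace ℝ (Fin n)) (𝓡 n) (extChartAt (𝓡 n) x).symm u
      (EuclideanSpace.single j 1))

variable [IsManifold (𝓡 n) ∞ M]
  [IsContMDiffRiemannianBundle (𝓡 n) ∞ (EuclideanSpace ℝ (Fin n))
    (fun x : M => TangentSpace (𝓡 n) x)]

theorem mfderiv_symm_invertible (x : M) {u : EuclideanSpace ℝ (Fin n)}
    (hu : u ∈ (extChartAt (𝓡 n) x).target) :
    (mfderiv 𝓘(ℝ, EuclideanSpace ℝ (Fin n)) (𝓡 n) (extChartAt (𝓡 n) x).symm u).IsInvertible := by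
  have : IsManifold (𝓡 n) 1 M := .of_le (n := ∞) (by simp)
  have h := isInvertible_mfderivWithin_extChartAt_symm (I := 𝓡 n) hu
  rwa [ModelWithCorners.range_eq_univ, mfderivWithin_univ] at h

theorem continuousOn_gram (x : M) :
    ContinuousOn (gram (n := n) x) (extChartAt (𝓡 n) x).target := by
  have : IsManifold (𝓡 n) 1 M := .of_le (n := ∞) (by simp)
  have hR : IsContinuousRiemannianBundle (EuclideanSpace ℝ (Fin n))
      (fun x : M => TangentSpace (𝓡 n) x) := by
    obtain ⟨g, hg, hg'⟩ := IsContMDiffRiemannianBundle.exists_contMDiff (IB := 𝓡 n) (n := ∞)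
      (F := EuclideanSpace ℝ (Fin n)) (E := fun x : M => TangentSpace (𝓡 n) x)
    exact ⟨g, hg.continuous, hg'⟩
  have hopen : IsOpen (extChartAt (𝓡 n) x).target := isOpen_extChartAt_target x
  have hs : ContMDiffOn 𝓘(ℝ, EuclideanSpace ℝ (Fin n)) (𝓡 n) 1 (extChartAt (𝓡 n) x).symm
      (extChartAt (𝓡 n) x).target := contMDiffOn_extChartAt_symm x
  have ht := hs.continuousOn_tangentMapWithin le_rfl hopen.uniqueMDiffOn
  have hv : ∀ i : Fin n, ContinuousOn (fun u =>
      (⟨(extChartAt (𝓡 n) x).symm u,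
        mfderiv 𝓘(ℝ, EuclideanSpace ℝ (Fin n)) (𝓡 n) (extChartAt (𝓡 n) x).symm u
          (EuclideanSpace.single i 1)⟩ : TangentBundle (𝓡 n) M)) (extChartAt (𝓡 n) x).target := by
    intro i
    have hc : Continuous (fun u : EuclideanSpace ℝ (Fin n) =>
        (⟨u, EuclideanSpace.single i 1⟩ :
          TangentBundle 𝓘(ℝ, EuclideanSpace ℝ (Fin n)) (EuclideanSpace ℝ (Fin n)))) := by
      rw [← (tangentBundleModelSpaceHomeomorph
        𝓘(ℝ, EuclideanSpace ℝ (Fin n))).comp_continuous_iff]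
      exact continuous_id.prodMk continuous_const
    refine (ht.comp hc.continuousOn (fun u hu => hu)).congr fun u hu => ?_
    simp only [Function.comp, tangentMapWithin]
    rw [mfderivWithin_of_isOpen hopen hu]
  refine continuousOn_pi.mpr fun i => continuousOn_pi.mpr fun j => ?_
  exact ContinuousOn.inner_bundle (hv i) (hv j)

/-- The coordinate basis of the tangent space at the point with coordinates `u`. -/
def chartBasis (x : M) {u : EuclideanSpace ℝ (Fin n)} (hu : u ∈ (extChartAt (𝓡 n) x).target) :
    Module.Basis (Fin n) ℝ (TangentSpace (𝓡 n) ((extChartAt (𝓡 n) x).symm u)) :=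
  (EuclideanSpace.basisFun (Fin n) ℝ).toBasis.map
    (mfderiv_symm_invertible x hu).choose.toLinearEquiv

theorem chartBasis_apply (x : M) {u : EuclideanSpace ℝ (Fin n)}
    (hu : u ∈ (extChartAt (𝓡 n) x).target) (i : Fin n) :
    chartBasis x hu i = mfderiv 𝓘(ℝ, EuclideanSpace ℝ (Fin n)) (𝓡 n) (extChartAt (𝓡 n) x).symm u
      (EuclideanSpace.single i 1) := by
  have h := congrArg (fun L : EuclideanSpace ℝ (Fin n) →L[ℝ]
    TangentSpace (𝓡 n) ((extChartAt (𝓡 n) x).symm u) => L (EuclideanSpace.single i 1))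
    (mfderiv_symm_invertible x hu).choose_spec
  refine Eq.trans (Module.Basis.map_apply _ _ _) ?_
  rw [OrthonormalBasis.coe_toBasis, EuclideanSpace.basisFun_apply]
  exact h

theorem gram_eq (x : M) {u : EuclideanSpace ℝ (Fin n)} (hu : u ∈ (extChartAt (𝓡 n) x).target) :
    gram x u = Matrix.of fun i j => inner ℝ (chartBasis x hu i) (chartBasis x hu j) := by
  ext i j
  simp only [gram, Matrix.of_apply, chartBasis_apply]

theorem det_gram_ne_zero (x : M) {u : EuclideanSpace ℝ (Fin n)}
    (hu : u ∈ (extChartAt (𝓡 n) x).target) : (gram x u).det ≠ 0 := by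
  intro h0
  obtain ⟨v, hv, hv0⟩ := Matrix.exists_mulVec_eq_zero_iff.mpr h0
  apply hv
  rw [gram_eq x hu] at hv0
  set w := ∑ j, v j • chartBasis x hu j with hw
  have h1 : ∀ i, inner ℝ (chartBasis x hu i) w = 0 := by
    intro i
    have := congrFun hv0 i
    simp only [Matrix.mulVec, dotProduct, Matrix.of_apply, Pi.zero_apply] at this
    rw [hw, inner_sum, ← this]
    exact Finset.sum_congr rfl fun j _ => by rw [inner_smul_right, mul_comm]
  have h2 : w = 0 := by
    have h3 : inner ℝ w w = ∑ j, inner ℝ (v j • chartBasis x hu j) w := by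
      rw [← sum_inner]
    rw [← inner_self_eq_zero (𝕜 := ℝ), h3]
    exact Finset.sum_eq_zero fun j _ => by rw [inner_smul_left, h1]; simp
  have h3 := (Fintype.linearIndependent_iff.mp (chartBasis x hu).linearIndependent) v (hw ▸ h2)
  exact funext h3

theorem continuous_pairing [PathConnectedSpace M] {ρ : FundamentalGroup M x₀ →* (V ≃ₗᵢ[ℝ] V)}
    {k : ℕ} {α β : RawForm n V x₀ k} (hα : α ∈ smoothForms n ρ k) (hβ : β ∈ smoothForms n ρ k) :
    Continuous (pairing α β) := by
  rw [continuous_iff_continuousAt]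
  intro x
  set φ := extChartAt (𝓡 n) x with hφ
  let c : Path.Homotopic.Quotient x₀ x := .mk (PathConnectedSpace.somePath x₀ x)
  let F : EuclideanSpace ℝ (Fin n) → ℝ := fun u => ((k.factorial : ℝ))⁻¹ *
    ∑ p : Fin k → Fin n, ∑ q : Fin k → Fin n,
      (∏ l, (gram x u)⁻¹ (p l) (q l)) *
        inner ℝ (localRep α x c u fun l => EuclideanSpace.single (p l) 1)
          (localRep β x c u fun l => EuclideanSpace.single (q l) 1)
  have hopen : IsOpen φ.target := isOpen_extChartAt_target x
  have hmem : φ x ∈ φ.target := mem_extChartAt_target x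
  have hF : ContinuousAt F (φ x) := by
    have hG : ContinuousAt (gram (n := n) x) (φ x) :=
      (continuousOn_gram x).continuousAt (hopen.mem_nhds hmem)
    have hGi : ContinuousAt (fun u => (gram (n := n) x u)⁻¹) (φ x) := by
      simp only [Matrix.inv_def, Ring.inverse_eq_inv']
      have h1 : ContinuousAt (fun u => (gram (n := n) x u).det) (φ x) :=
        (Continuous.matrix_det continuous_id).continuousAt.comp hG
      have h2 : ContinuousAt (fun u => (gram (n := n) x u).adjugate) (φ x) :=
        (Continuous.matrix_adjugate continuous_id).continuousAt.comp hG
      exact (h1.inv₀ (det_gram_ne_zero x hmem)).smul h2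
    have hev : ∀ {γ : RawForm n V x₀ k}, γ ∈ smoothForms n ρ k → ∀ v,
        ContinuousAt (fun u => localRep γ x c u v) (φ x) := by
      intro γ hγ v
      exact ((ContinuousAlternatingMap.apply ℝ (EuclideanSpace ℝ (Fin n)) V
        v).continuous.continuousAt (x := localRep γ x c (φ x))).comp (hγ.2 x c).continuousAt
    refine continuousAt_const.mul (tendsto_finsetSum _ fun p _ => tendsto_finsetSum _ fun q _ => ?_)
    refine ContinuousAt.mul ?_ ((hev hα _).inner (hev hβ _))
    refine tendsto_finsetProd _ fun l _ => ?_
    exact (continuousAt_pi.mp (continuousAt_pi.mp hGi (p l)) (q l))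
  have heq : pairing α β =ᶠ[𝓝 x] fun y => F (φ y) := by
    obtain ⟨r, hr, hball⟩ := Metric.isOpen_iff.mp hopen _ hmem
    have h1 : ∀ᶠ y in 𝓝 x, φ y ∈ Metric.ball (φ x) r :=
      (continuousAt_extChartAt x).eventually (Metric.ball_mem_nhds _ hr)
    filter_upwards [h1, extChartAt_source_mem_nhds (I := 𝓡 n) x] with y hy hys
    have hseg : segment ℝ (φ x) (φ y) ⊆ φ.target :=
      ((convex_ball (φ x) r).segment_subset (Metric.mem_ball_self hr) hy).trans hball
    obtain ⟨u, hu, rfl⟩ : ∃ u ∈ φ.target, y = φ.symm u :=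
      ⟨φ y, φ.map_source hys, (φ.left_inv hys).symm⟩
    rw [φ.right_inv hu] at hseg ⊢
    rw [pairing_eq hα hβ _ (c.trans (.mk (chartRay x u hseg))),
      altInner_eq_gram (chartBasis x hu), ← gram_eq x hu]
    simp only [F, localRep]
    rw [dif_pos hseg]
    rw [dif_pos hseg]
    simp only [chartBasis_apply]
    rfl
  exact (ContinuousAt.comp (f := φ) (g := F) hF (continuousAt_extChartAt x)).congr heq.symm

section Volume

variable [MeasurableSpace M] [BorelSpace M]

/-- The measure on the domain of the chart `φ` at `x` which is `√(det g) du` in coordinates. -/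
def chartVolume (x : M) : Measure M :=
  ((volume.restrict (extChartAt (𝓡 n) x).target).withDensity
    fun u => ENNReal.ofReal (√(gram (n := n) x u).det)).map (extChartAt (𝓡 n) x).symm

variable [CompactSpace M] [T2Space M]

variable (n M) in
/-- A partition of unity subordinate to the domains of the charts. -/
def chartPartition : SmoothPartitionOfUnity M (𝓡 n) M univ :=
  (SmoothPartitionOfUnity.exists_isSubordinate_chartAt_source (𝓡 n) M).choose

variable (n M) in
/-- The Riemannian volume measure `∑ f_x √(det g) du` of a closed Riemannian manifold. -/
def riemannianVolume : Measure M :=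
  Measure.sum fun x => (chartVolume (n := n) x).withDensity
    fun y => ENNReal.ofReal (chartPartition n M x y)

theorem chartVolume_lt_top (x : M) {K : Set M} (hK : IsCompact K)
    (hKx : K ⊆ (chartAt (EuclideanSpace ℝ (Fin n)) x).source) :
    chartVolume (n := n) x K < ⊤ := by
  set φ := extChartAt (𝓡 n) x with hφ
  have hopen : IsOpen φ.target := isOpen_extChartAt_target x
  have hKx' : K ⊆ φ.source := by rwa [hφ, extChartAt_source]
  have hm : AEMeasurable φ.symm ((volume.restrict φ.target).withDensity
      fun u => ENNReal.ofReal (√(gram (n := n) x u).det)) :=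
    ((continuousOn_extChartAt_symm x).aemeasurable hopen.measurableSet).mono_ac
      (withDensity_absolutelyContinuous _ _)
  have hL : IsCompact (φ '' K) := hK.image_of_continuousOn
    ((continuousOn_extChartAt x).mono hKx')
  have hLt : φ '' K ⊆ φ.target := by
    rintro _ ⟨y, hy, rfl⟩; exact φ.map_source (hKx' hy)
  have hcont : ContinuousOn (fun u => √(gram (n := n) x u).det) φ.target :=
    ((Continuous.matrix_det continuous_id).comp_continuousOn (continuousOn_gram x)).sqrt
  obtain ⟨C, hC⟩ := hL.exists_bound_of_continuousOn (hcont.mono hLt)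
  rw [chartVolume, Measure.map_apply_of_aemeasurable hm hK.measurableSet]
  calc _ ≤ ((volume.restrict φ.target).withDensity
          fun u => ENNReal.ofReal (√(gram (n := n) x u).det)) (φ '' K ∪ φ.targetᶜ) := by
        refine measure_mono fun u hu => ?_
        by_cases hut : u ∈ φ.target
        · exact Or.inl ⟨_, hu, φ.right_inv hut⟩
        · exact Or.inr hut
    _ ≤ ((volume.restrict φ.target).withDensity
          fun u => ENNReal.ofReal (√(gram (n := n) x u).det)) (φ '' K) +
        ((volume.restrict φ.target).withDensity
          fun u => ENNReal.ofReal (√(gram (n := n) x u).det)) φ.targetᶜ := measure_union_le _ _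
    _ = ((volume.restrict φ.target).withDensity
          fun u => ENNReal.ofReal (√(gram (n := n) x u).det)) (φ '' K) := by
        have h0 : (volume.restrict φ.target) φ.targetᶜ = 0 := by
          rw [Measure.restrict_apply hopen.measurableSet.compl]; simp
        rw [withDensity_absolutelyContinuous _ _ h0, add_zero]
    _ = ∫⁻ u in φ '' K, ENNReal.ofReal (√(gram (n := n) x u).det) ∂(volume.restrict φ.target) :=
        withDensity_apply _ hL.measurableSet
    _ ≤ ∫⁻ u in φ '' K, ENNReal.ofReal C ∂(volume.restrict φ.target) := by
        refine setLIntegral_mono measurable_const fun u hu => ENNReal.ofReal_le_ofReal ?_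
        exact (le_abs_self _).trans (hC u hu)
    _ < ⊤ := by
        rw [setLIntegral_const]
        exact ENNReal.mul_lt_top ENNReal.ofReal_lt_top
          ((Measure.restrict_apply_le _ _).trans_lt hL.measure_lt_top)

instance isFiniteMeasure_riemannianVolume : IsFiniteMeasure (riemannianVolume n M) := by
  refine ⟨?_⟩
  have hsub := (SmoothPartitionOfUnity.exists_isSubordinate_chartAt_source (𝓡 n) M).choose_spec
  rw [riemannianVolume, Measure.sum_apply _ MeasurableSet.univ]
  have hfin : {x : M | (Function.support (chartPartition n M x)).Nonempty}.Finite :=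
    (chartPartition n M).locallyFinite.finite_nonempty_of_compact
  have hle : ∀ x : M, ((chartVolume (n := n) x).withDensity
      fun y => ENNReal.ofReal (chartPartition n M x y)) univ < ⊤ := by
    intro x
    have hK : IsCompact (tsupport (chartPartition n M x)) := (isClosed_tsupport _).isCompact
    rw [withDensity_apply _ MeasurableSet.univ, Measure.restrict_univ]
    refine lt_of_le_of_lt (b := chartVolume (n := n) x (tsupport (chartPartition n M x))) ?_
      (chartVolume_lt_top x hK (hsub x))
    rw [← lintegral_indicator_one hK.measurableSet]
    refine lintegral_mono fun y => ?_
    by_cases hy : y ∈ tsupport (chartPartition n M x)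
    · rw [indicator_of_mem hy]
      exact ENNReal.ofReal_le_one.mpr ((chartPartition n M).le_one x y)
    · rw [image_eq_zero_of_notMem_tsupport hy]; simp
  rw [tsum_eq_sum (s := hfin.toFinset)]
  · exact ENNReal.sum_lt_top.mpr fun x _ => hle x
  · intro x hx
    have hx' : ∀ y, chartPartition n M x y = 0 := by
      intro y
      by_contra hy
      exact hx (hfin.mem_toFinset.mpr ⟨y, hy⟩)
    simp [hx']

theorem integrable_pairing [PathConnectedSpace M] {ρ : FundamentalGroup M x₀ →* (V ≃ₗᵢ[ℝ] V)}
    {k : ℕ} {α β : RawForm n V x₀ k} (hα : α ∈ smoothForms n ρ k) (hβ : β ∈ smoothForms n ρ k) :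
    Integrable (pairing α β) (riemannianVolume n M) :=
  (continuous_pairing hα hβ).integrable_of_hasCompactSupport (HasCompactSupport.of_compactSpace _)

end Volume

end Riemannian

variable (n) in
/-- `Ωᵏ`, the space of smooth `k`-forms with values in `E(ρ)`, as an `L²` inner product space. -/
def TwistedForm (ρ : FundamentalGroup M x₀ →* (V ≃ₗᵢ[ℝ] V)) (k : ℕ) : Type _ :=
  smoothForms n ρ k

variable {ρ : FundamentalGroup M x₀ →* (V ≃ₗᵢ[ℝ] V)}

instance (k : ℕ) : AddCommGroup (TwistedForm n ρ k) :=
  inferInstanceAs (AddCommGroup (smoothForms n ρ k))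

instance (k : ℕ) : Module ℝ (TwistedForm n ρ k) :=
  inferInstanceAs (Module ℝ (smoothForms n ρ k))

variable (n ρ) in
/-- The exterior differential on `Ωᵏ`. -/
def dLinear (k : ℕ) : TwistedForm n ρ k →ₗ[ℝ] RawForm n V x₀ (k + 1) where
  toFun α := extD α.1
  map_add' α β := by
    funext x c
    have hα : DifferentiableAt ℝ (localRep α.1 x c) (extChartAt (𝓡 n) x x) :=
      (α.2.2 x c).differentiableAt (by simp)
    have hβ : DifferentiableAt ℝ (localRep β.1 x c) (extChartAt (𝓡 n) x x) :=
      (β.2.2 x c).differentiableAt (by simp)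
    change extD (α.1 + β.1) x c = extD α.1 x c + extD β.1 x c
    simp only [extD]
    rw [localRep_add, extDeriv_add hα hβ]
    rfl
  map_smul' r α := by
    funext x c
    change extD (r • α.1) x c = r • extD α.1 x c
    simp only [extD]
    rw [localRep_smul, extDeriv_smul]
    rfl

variable (n ρ) in
/-- The exact part `Ω'ₖ = Im d_{k-1}` of `Ωᵏ` (zero for `k = 0`). -/
def exactForms : (k : ℕ) → Submodule ℝ (TwistedForm n ρ k)
  | 0 => ⊥
  | k + 1 => (LinearMap.range (dLinear n ρ k)).comap (smoothForms n ρ (k + 1)).subtype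

variable (n ρ) in
/-- All cohomology groups `H^k(M, ρ)` vanish: every closed form is exact. -/
def IsAcyclic : Prop := ∀ k : ℕ, LinearMap.ker (dLinear n ρ k) ≤ exactForms n ρ k

section L2

variable [RiemannianBundle (fun x : M => TangentSpace (𝓡 n) x)] [IsManifold (𝓡 n) ∞ M]
  [IsContMDiffRiemannianBundle (𝓡 n) ∞ (EuclideanSpace ℝ (Fin n))
    (fun x : M => TangentSpace (𝓡 n) x)]
  [MeasurableSpace M] [BorelSpace M] [CompactSpace M] [T2Space M] [PathConnectedSpace M]

variable (n ρ) in
/-- The `L²` inner product on `Ωᵏ`. -/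
@[reducible] def l2Core (k : ℕ) : PreInnerProductSpace.Core ℝ (TwistedForm n ρ k) where
  inner α β := ∫ x, pairing α.1 β.1 x ∂(riemannianVolume n M)
  conj_inner_symm α β := by
    simp only [conj_trivial]
    exact integral_congr_ae (.of_forall fun x => altInner_comm _ _)
  re_inner_nonneg α := integral_nonneg fun x => altInner_self_nonneg _
  add_left α β γ := by
    rw [← integral_add (integrable_pairing α.2 γ.2) (integrable_pairing β.2 γ.2)]
    exact integral_congr_ae (.of_forall fun x => altInner_add_left _ _ _)
  smul_left α β r := by
    simp only [conj_trivial]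
    rw [← integral_const_mul]
    exact integral_congr_ae (.of_forall fun x => altInner_smul_left _ _ _)

instance (k : ℕ) : SeminormedAddCommGroup (TwistedForm n ρ k) :=
  @InnerProductSpace.Core.toSeminormedAddCommGroup ℝ _ _ _ _ (l2Core n ρ k)

instance (k : ℕ) : InnerProductSpace ℝ (TwistedForm n ρ k) :=
  @InnerProductSpace.ofCore ℝ _ _ _ _ (l2Core n ρ k)

theorem inner_def {k : ℕ} (α β : TwistedForm n ρ k) :
    inner ℝ α β = ∫ x, pairing α.1 β.1 x ∂(riemannianVolume n M) := rfl

variable (n ρ) in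
/-- The Hilbert space `Hₖ = L²(Ωᵏ)`, the completion of `Ωᵏ` for the `L²` inner product. -/
abbrev L2Forms (k : ℕ) : Type _ := UniformSpace.Completion (TwistedForm n ρ k)

variable (n ρ) in
/-- The closed subspace `H'ₖ` of `Hₖ`, the closure of the exact forms. -/
abbrev L2Exact (k : ℕ) : Submodule ℝ (L2Forms n ρ k) :=
  ((exactForms n ρ k).map
    (UniformSpace.Completion.toComplL (𝕜 := ℝ) (E := TwistedForm n ρ k)).toLinearMap
    ).topologicalClosure

variable (n ρ) in
/-- The projection `α ↦ α'` of `Hₖ = H'ₖ ⊕ H''ₖ` onto `H'ₖ`; `H''ₖ` is the orthogonal complement. -/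
def exactPart (k : ℕ) : L2Forms n ρ k →L[ℝ] L2Exact n ρ k := 
  (L2Exact n ρ k).orthogonalProjectionOnto

end L2

end Manifold

section Gaussian

variable {H K : Type*} [NormedAddCommGroup H] [InnerProductSpace ℝ H] [CompleteSpace H]
  [NormedAddCommGroup K] [InnerProductSpace ℝ K] [CompleteSpace K]

variable (H K) in
/-- A Hilbert-Schmidt extension of the Hilbert space `H`: a Hilbert space `K` in which `H` is
embedded densely by an injective Hilbert-Schmidt operator. -/
structure HilbertSchmidtExtension where
  incl : H →L[ℝ] K
  injective : Function.Injective incl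
  denseRange : DenseRange incl
  hilbertSchmidt : ∀ s : Set H, Orthonormal ℝ ((↑) : s → H) →
    Summable fun e : s => ‖incl e‖ ^ 2

namespace HilbertSchmidtExtension

variable (J : HilbertSchmidtExtension H K)

/-- The Hilbert space `K` is its own dual, and `y : K` restricts to a continuous linear form on `H`,
that is, to a vector `J.test y` of `H` with `⟪J.test y, ξ⟫ = ⟪y, ξ⟫` for `ξ` in `H`. The vectors of
this form, the test vectors, are those vectors of `H` whose pairing with `H` extends continuously
to `K`, the pairing of `J.test y` with `φ` in `K` being `⟪y, φ⟫`. -/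
def test : K →L[ℝ] H := ContinuousLinearMap.adjoint J.incl

theorem inner_test (y : K) (ξ : H) : inner ℝ (J.test y) ξ = inner ℝ y (J.incl ξ) :=
  ContinuousLinearMap.adjoint_inner_left _ _ _

theorem test_injective : Function.Injective J.test := by
  rw [injective_iff_map_eq_zero]
  intro y hy
  have h : ∀ z : K, inner ℝ y z = 0 := fun z =>
    J.denseRange.induction_on (p := fun z => inner ℝ y z = 0) z
      (isClosed_eq (by fun_prop) continuous_const) fun ξ => by
        rw [← J.inner_test, hy, inner_zero_left]
  exact inner_self_eq_zero.mp (h y)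

theorem exists_truncation (F : Finset K) (η : K) :
    ∃ z ∈ Submodule.span ℝ (F : Set K), ∀ y ∈ Submodule.span ℝ (F : Set K),
      inner ℝ (J.test y) (J.test z) = inner ℝ y η := by
  let S := Submodule.span ℝ (F : Set K)
  have : FiniteDimensional ℝ S := FiniteDimensional.span_finset ℝ F
  let B : S →ₗ[ℝ] Module.Dual ℝ S := LinearMap.mk₂ ℝ
    (fun z y => inner ℝ (J.test y) (J.test z))
    (by intros; simp [inner_add_right]) (by intros; simp [inner_smul_right])
    (by intros; simp [inner_add_left]) (by intros; simp [inner_smul_left])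
  have hB : Function.Injective B := by
    rw [injective_iff_map_eq_zero]
    intro z hz
    have h1 : inner ℝ (J.test z) (J.test z) = 0 := LinearMap.congr_fun hz z
    have h2 := J.test_injective ((inner_self_eq_zero.mp h1).trans (map_zero J.test).symm)
    exact Subtype.ext h2
  have hs : Function.Surjective B :=
    (LinearMap.injective_iff_surjective_of_finrank_eq_finrank
      (Subspace.dual_finrank_eq (K := ℝ) (V := S)).symm).mp hB
  obtain ⟨z, hz⟩ := hs ((innerₗ K η).comp S.subtype)
  refine ⟨z, z.2, fun y hy => ?_⟩
  have := LinearMap.congr_fun hz ⟨y, hy⟩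
  rw [real_inner_comm η y]
  exact this

/-- The truncation of a generalized vector `η` in `K` to the finite-dimensional space of test vectors
spanned by `J.test y` for `y ∈ F`: the element `z` of the span of `F` for which `J.test z` is the
orthogonal projection of `η` to this space, that is,
`⟪J.test y, J.test z⟫ = ⟪J.test y, η⟫` (the pairing of test vectors and generalized vectors, which
is `⟪y, η⟫`) for all `y` in the span of `F`. -/
def truncate (F : Finset K) (η : K) : K := (J.exists_truncation F η).choose

/-- The extension to `K` of a function `ξ ↦ χ ξ` of test vectors: its value at `η` in `K` is the
limit of its values at the truncations of `η`, along the directed set of the finite-dimensional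
spaces of test vectors. Here `χ` is written as a function of `y`, with `ξ = J.test y`. -/
def extend (χ : K → ℂ) (η : K) : ℂ :=
  limUnder atTop fun F : Finset K => χ (J.truncate F η)

/-- `μ` is the Gaussian measure on the extension `K` of `H` with characteristic function
`ξ ↦ exp (-(a / 2) ⟪ξ, ξ⟫)`: for every test vector `ξ = J.test y`, the integral of
`φ ↦ exp (i ⟪ξ, φ⟫)` is `exp (-(a / 2) ⟪ξ, ξ⟫)`. -/
structure IsGaussian [MeasurableSpace K] (a : ℝ) (μ : Measure K) : Prop where
  isProbabilityMeasure : IsProbabilityMeasure μ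
  charFun_eq : ∀ y : K, charFun μ y = Complex.exp (-(a / 2) * ‖J.test y‖ ^ 2 : ℝ)

end HilbertSchmidtExtension

end Gaussian

end TwistedForms

end

/-!
Since the projection `P : H → H'` is a co-isometry, the push-forward of a Gaussian measure along its
extension `Q : K → K'` is again Gaussian, with the same parameter, so both integrals live on `K'`.
There the truncation to a finite-dimensional space of test vectors is a symmetric operator, and the
truncated identity is Fubini's theorem for the kernel `exp (i ⟪φ, P_S η⟫)`.

For the limit, `‖P_S η‖² = max_{y ∈ S} (2 ⟪y, η⟫ - ‖y‖²)` increases with `S`, so the Gaussian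
characteristic functions of the truncations decrease to an infimum over all `y`. By continuity in
`y` the infimum can be computed on a countable dense set; hence the limit over all `S` agrees with
the limit along a countable directed family, to which dominated convergence applies.
-/

namespace TwistedForms

open scoped InnerProductSpace

theorem separableSpace_of_forall_orthonormal_countable (𝕜 : Type*) {E : Type*} [RCLike 𝕜]
    [NormedAddCommGroup E] [InnerProductSpace 𝕜 E] [CompleteSpace E]
    (h : ∀ s : Set E, Orthonormal 𝕜 ((↑) : s → E) → s.Countable) :
    TopologicalSpace.SeparableSpace E := by
  obtain ⟨w, e, he⟩ := exists_hilbertBasis 𝕜 E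
  have : Countable w := (h w (he ▸ e.orthonormal)).to_subtype
  let _ : NormedSpace ℝ E := NormedSpace.restrictScalars ℝ 𝕜 E
  rw [← TopologicalSpace.isSeparable_univ_iff, ← Submodule.top_coe (R := 𝕜), ← e.dense_span,
    Submodule.topologicalClosure_coe]
  exact ((countable_range e).isSeparable.span (R := 𝕜)).closure

theorem bddBelow_range_exp {ι : Type*} (f : ι → ℝ) : BddBelow (range fun i => Real.exp (f i)) :=
  ⟨0, forall_mem_range.mpr fun _ => (Real.exp_pos _).le⟩

theorem antitone_exp_neg_half_mul {c : ℝ} (hc : 0 ≤ c) :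
    Antitone fun t : ℝ => Real.exp (-(c / 2) * t) := fun s t hst =>
  Real.exp_le_exp.mpr (mul_le_mul_of_nonpos_left hst (by linarith))

section CharFun

variable {E F : Type*} [NormedAddCommGroup E] [InnerProductSpace ℝ E] [MeasurableSpace E]
  [OpensMeasurableSpace E] [NormedAddCommGroup F] [InnerProductSpace ℝ F] [MeasurableSpace F]

theorem charFun_map_continuousLinearMap [CompleteSpace E] [CompleteSpace F] [BorelSpace F]
    (L : E →L[ℝ] F) (μ : Measure E) (y : F) :
    charFun (μ.map L) y = charFun μ (L.adjoint y) := by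
  rw [charFun_apply, charFun_apply, integral_map (by fun_prop) (by fun_prop)]
  simp only [ContinuousLinearMap.adjoint_inner_right]

theorem integrable_charFun_comp {X : Type*} [MeasurableSpace X] [SecondCountableTopology E]
    (μ : Measure E) [IsFiniteMeasure μ] (ν : Measure X) [IsFiniteMeasure ν] {f : X → E}
    (hf : Measurable f) : Integrable (fun x => charFun μ (f x)) ν :=
  .of_bound (stronglyMeasurable_charFun.comp_measurable hf).aestronglyMeasurable
    (μ.real univ) (.of_forall fun _ => norm_charFun_le _)

theorem integral_charFun_continuousLinearMap [CompleteSpace E] [CompleteSpace F]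
    [OpensMeasurableSpace F] [SecondCountableTopology E] (T : E →L[ℝ] F)
    (μ : Measure F) [IsFiniteMeasure μ] (ν : Measure E) [IsFiniteMeasure ν] :
    ∫ x, charFun μ (T x) ∂ν = ∫ y, charFun ν (T.adjoint y) ∂μ := by
  have hint : Integrable (fun p : E × F => Complex.exp (⟪p.2, T p.1⟫_ℝ * Complex.I))
      (ν.prod μ) := by
    refine .of_bound (Continuous.aestronglyMeasurable (by fun_prop)) 1 (.of_forall fun p => ?_)
    rw [Complex.norm_exp_ofReal_mul_I]
  simp only [charFun_apply]
  rw [integral_integral_swap hint]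
  simp only [ContinuousLinearMap.adjoint_inner_right, real_inner_comm]

end CharFun

namespace HilbertSchmidtExtension

variable {H K : Type*} [NormedAddCommGroup H] [InnerProductSpace ℝ H] [CompleteSpace H]
  [NormedAddCommGroup K] [InnerProductSpace ℝ K]

theorem separableSpace (J : HilbertSchmidtExtension H K) : TopologicalSpace.SeparableSpace K := by
  have : TopologicalSpace.SeparableSpace H := by
    refine separableSpace_of_forall_orthonormal_countable ℝ fun s hs => ?_
    have hsupp : Function.support (fun x : s => ‖J.incl x‖ ^ 2) = univ := by
      refine eq_univ_of_forall fun x => pow_ne_zero 2 (norm_ne_zero_iff.mpr ?_)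
      exact (map_ne_zero_iff J.incl J.injective).mpr (hs.ne_zero x)
    rw [← countable_coe_iff, ← countable_univ_iff, ← hsupp]
    exact (J.hilbertSchmidt s hs).countable_support
  exact J.denseRange.separableSpace J.incl.continuous

variable [CompleteSpace K] (J : HilbertSchmidtExtension H K)

theorem truncate_mem_span (F : Finset K) (η : K) :
    J.truncate F η ∈ Submodule.span ℝ (F : Set K) :=
  (J.exists_truncation F η).choose_spec.1

theorem inner_test_truncate {F : Finset K} {y : K} (hy : y ∈ Submodule.span ℝ (F : Set K))
    (η : K) : ⟪J.test y, J.test (J.truncate F η)⟫_ℝ = ⟪y, η⟫_ℝ :=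
  (J.exists_truncation F η).choose_spec.2 y hy

theorem inner_truncate_left (F : Finset K) (η φ : K) :
    ⟪J.truncate F η, φ⟫_ℝ = ⟪η, J.truncate F φ⟫_ℝ := by
  rw [← J.inner_test_truncate (J.truncate_mem_span F η), real_inner_comm,
    J.inner_test_truncate (J.truncate_mem_span F φ), real_inner_comm]

/-- Truncation of generalized vectors to the test vectors spanned by `F`, as a self-adjoint bounded
operator. Symmetry determines everything: it yields linearity, and then boundedness by the
Hellinger-Toeplitz theorem. -/
noncomputable def truncateCLM (F : Finset K) : K →L[ℝ] K :=
  LinearMap.IsSymmetric.toSelfAdjoint (T :=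
    { toFun := J.truncate F
      map_add' := fun η φ => ext_inner_right ℝ fun ψ => by
        simp only [inner_truncate_left, inner_add_left]
      map_smul' := fun r η => ext_inner_right ℝ fun ψ => by
        simp only [inner_truncate_left, real_inner_smul_left, RingHom.id_apply] })
    (J.inner_truncate_left F)

theorem truncateCLM_apply (F : Finset K) (η : K) : J.truncateCLM F η = J.truncate F η := rfl

theorem adjoint_truncateCLM (F : Finset K) : (J.truncateCLM F).adjoint = J.truncateCLM F :=
  LinearMap.IsSymmetric.clm_adjoint_eq (J.inner_truncate_left F)

theorem continuous_truncate (F : Finset K) : Continuous (J.truncate F) :=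
  (J.truncateCLM F).continuous

theorem isGreatest_norm_test_truncate_sq (F : Finset K) (η : K) :
    IsGreatest ((fun y => 2 * ⟪y, η⟫_ℝ - ‖J.test y‖ ^ 2) '' Submodule.span ℝ (F : Set K))
      (‖J.test (J.truncate F η)‖ ^ 2) := by
  refine ⟨⟨J.truncate F η, J.truncate_mem_span F η, ?_⟩, ?_⟩
  · simp only [← J.inner_test_truncate (J.truncate_mem_span F η), real_inner_self_eq_norm_sq]
    ring
  · rintro _ ⟨y, hy, rfl⟩
    have hsq := norm_sub_sq_real (J.test y) (J.test (J.truncate F η))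
    rw [J.inner_test_truncate hy] at hsq
    linarith [sq_nonneg ‖J.test y - J.test (J.truncate F η)‖]

theorem monotone_norm_test_truncate_sq (η : K) :
    Monotone fun F : Finset K => ‖J.test (J.truncate F η)‖ ^ 2 := fun F G hFG =>
  (J.isGreatest_norm_test_truncate_sq F η).mono (J.isGreatest_norm_test_truncate_sq G η)
    (image_mono (Submodule.span_mono (Finset.coe_subset.mpr hFG)))

/-- The extension of `ξ ↦ exp (-(c / 2) ‖ξ‖²)` from the test vectors to the generalized vectors `η`.
By duality `‖η‖²` should be read as the supremum of `2 ⟪y, η⟫ - ‖J.test y‖²` over `y`; this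
supremum is infinite unless `η` comes from `H`, so the definition takes the infimum of the
exponentials, which for `0 < c` is then `0`. -/
noncomputable def gaussianExtension (c : ℝ) (η : K) : ℝ :=
  ⨅ y : K, Real.exp (-(c / 2) * (2 * ⟪y, η⟫_ℝ - ‖J.test y‖ ^ 2))

theorem measurable_gaussianExtension [MeasurableSpace K] [BorelSpace K] (c : ℝ) :
    Measurable (J.gaussianExtension c) :=
  (upperSemicontinuous_ciInf (fun _ => bddBelow_range_exp _) fun _ =>
    Continuous.upperSemicontinuous (by fun_prop)).measurable

theorem gaussianExtension_nonneg (c : ℝ) (η : K) : 0 ≤ J.gaussianExtension c η :=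
  Real.iInf_nonneg fun _ => (Real.exp_pos _).le

theorem gaussianExtension_le_one (c : ℝ) (η : K) : J.gaussianExtension c η ≤ 1 :=
  (ciInf_le (bddBelow_range_exp _) 0).trans_eq (by simp)

theorem integrable_gaussianExtension [MeasurableSpace K] [BorelSpace K] (c : ℝ) (ν : Measure K)
    [IsFiniteMeasure ν] : Integrable (J.gaussianExtension c) ν :=
  .of_bound (J.measurable_gaussianExtension c).aestronglyMeasurable 1 <| .of_forall fun η =>
    (Real.norm_of_nonneg (J.gaussianExtension_nonneg c η)).trans_le
      (J.gaussianExtension_le_one c η)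

section Limit

variable {ι : Type*} {G : ι → Finset K} {c : ℝ}

theorem gaussianExtension_eq_iInf_truncate (hdense : Dense (⋃ i, (G i : Set K))) (hc : 0 ≤ c)
    (η : K) : J.gaussianExtension c η =
      ⨅ i, Real.exp (-(c / 2) * ‖J.test (J.truncate (G i) η)‖ ^ 2) := by
  have : Nonempty ι := by
    obtain ⟨y, hy⟩ := hdense.nonempty
    exact (mem_iUnion.mp hy).nonempty
  refine le_antisymm (le_ciInf fun i => ?_) (le_ciInf fun y => ?_)
  · obtain ⟨y, -, hy⟩ := (J.isGreatest_norm_test_truncate_sq (G i) η).1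
    rw [← hy]
    exact ciInf_le (bddBelow_range_exp _) y
  · refine hdense.induction (fun y hy => ?_)
      (isClosed_le continuous_const (g := fun y => Real.exp (-(c / 2) *
        (2 * ⟪y, η⟫_ℝ - ‖J.test y‖ ^ 2))) (by fun_prop)) y
    obtain ⟨i, hi⟩ := mem_iUnion.mp hy
    exact (ciInf_le (bddBelow_range_exp _) i).trans (antitone_exp_neg_half_mul hc
      ((J.isGreatest_norm_test_truncate_sq (G i) η).2 ⟨y, Submodule.subset_span hi, rfl⟩))

theorem tendsto_exp_norm_test_truncate [Preorder ι] (hG : Monotone G)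
    (hdense : Dense (⋃ i, (G i : Set K))) (hc : 0 ≤ c) (η : K) :
    Tendsto (fun i => Real.exp (-(c / 2) * ‖J.test (J.truncate (G i) η)‖ ^ 2)) atTop
      (𝓝 (J.gaussianExtension c η)) := by
  rw [J.gaussianExtension_eq_iInf_truncate hdense hc]
  exact tendsto_atTop_ciInf ((antitone_exp_neg_half_mul hc).comp_monotone
    ((J.monotone_norm_test_truncate_sq η).comp hG)) (bddBelow_range_exp _)

end Limit

namespace IsGaussian

variable {J} [MeasurableSpace K] {a : ℝ} {μ : Measure K}

theorem map [BorelSpace K] {H' K' : Type*} [NormedAddCommGroup H'] [InnerProductSpace ℝ H']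
    [CompleteSpace H'] [NormedAddCommGroup K'] [InnerProductSpace ℝ K'] [CompleteSpace K']
    [MeasurableSpace K'] [BorelSpace K'] {J' : HilbertSchmidtExtension H' K'}
    (hμ : J.IsGaussian a μ) {P : H →L[ℝ] H'} (hP : ∀ ξ, ‖P.adjoint ξ‖ = ‖ξ‖) {Q : K →L[ℝ] K'}
    (hQ : ∀ ξ, Q (J.incl ξ) = J'.incl (P ξ)) : J'.IsGaussian a (μ.map Q) where
  isProbabilityMeasure :=
    have := hμ.isProbabilityMeasure
    Measure.isProbabilityMeasure_map (by fun_prop)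
  charFun_eq y := by
    have htest : J.test (Q.adjoint y) = P.adjoint (J'.test y) := ext_inner_right ℝ fun ξ => by
      rw [inner_test, ContinuousLinearMap.adjoint_inner_left, hQ,
        ContinuousLinearMap.adjoint_inner_left, inner_test]
    rw [charFun_map_continuousLinearMap, hμ.charFun_eq, htest, hP]

theorem tendsto_charFun_truncate {ι : Type*} [Preorder ι] {G : ι → Finset K} (hG : Monotone G)
    (hdense : Dense (⋃ i, (G i : Set K))) (ha : 0 ≤ a) (hμ : J.IsGaussian a μ) (η : K) :
    Tendsto (fun i => charFun μ (J.truncate (G i) η)) atTop (𝓝 (J.gaussianExtension a η : ℂ)) := by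
  simp only [hμ.charFun_eq, ← Complex.ofReal_exp]
  exact (Complex.continuous_ofReal.tendsto _).comp
    (J.tendsto_exp_norm_test_truncate hG hdense ha η)

theorem tendsto_charFun_truncate_atTop (ha : 0 ≤ a) (hμ : J.IsGaussian a μ) (η : K) :
    Tendsto (fun F : Finset K => charFun μ (J.truncate F η)) atTop
      (𝓝 (J.gaussianExtension a η : ℂ)) := by
  have hcover : ⋃ F : Finset K, (F : Set K) = univ :=
    iUnion_eq_univ_iff.mpr fun y => ⟨{y}, by simp⟩
  exact hμ.tendsto_charFun_truncate monotone_id (hcover ▸ dense_univ) ha η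

theorem extend_charFun (ha : 0 ≤ a) (hμ : J.IsGaussian a μ) (η : K) :
    J.extend (charFun μ) η = J.gaussianExtension a η :=
  (hμ.tendsto_charFun_truncate_atTop ha η).limUnder_eq

theorem integrable_extend_charFun [BorelSpace K] (ha : 0 ≤ a) (hμ : J.IsGaussian a μ)
    (ν : Measure K) [IsFiniteMeasure ν] : Integrable (J.extend (charFun μ)) ν := by
  rw [funext (hμ.extend_charFun ha)]
  exact (J.integrable_gaussianExtension a ν).ofReal

theorem tendsto_integral_charFun_truncate [BorelSpace K] {ι : Type*} [Preorder ι]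
    [(atTop : Filter ι).IsCountablyGenerated] {G : ι → Finset K} (hG : Monotone G)
    (hdense : Dense (⋃ i, (G i : Set K))) (ha : 0 ≤ a) (hμ : J.IsGaussian a μ) (ν : Measure K)
    [IsFiniteMeasure ν] :
    Tendsto (fun i => ∫ η, charFun μ (J.truncate (G i) η) ∂ν) atTop
      (𝓝 (∫ η, J.extend (charFun μ) η ∂ν)) := by
  have := J.separableSpace
  have := UniformSpace.secondCountable_of_separable K
  have := hμ.isProbabilityMeasure
  simp only [hμ.extend_charFun ha]
  exact tendsto_integral_filter_of_dominated_convergence (fun _ => 1)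
    (.of_forall fun i => (integrable_charFun_comp μ ν
      (J.continuous_truncate (G i)).measurable).aestronglyMeasurable)
    (.of_forall fun i => .of_forall fun η => norm_charFun_le_one _) (integrable_const 1)
    (.of_forall fun η => hμ.tendsto_charFun_truncate hG hdense ha η)

end IsGaussian

theorem integral_charFun_truncate_comm [MeasurableSpace K] [BorelSpace K] (μ ν : Measure K)
    [IsFiniteMeasure μ] [IsFiniteMeasure ν] (F : Finset K) :
    ∫ η, charFun μ (J.truncate F η) ∂ν = ∫ φ, charFun ν (J.truncate F φ) ∂μ := by
  have := J.separableSpace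
  have := UniformSpace.secondCountable_of_separable K
  simpa only [adjoint_truncateCLM, truncateCLM_apply] using
    integral_charFun_continuousLinearMap (J.truncateCLM F) μ ν

theorem IsGaussian.integral_extend_charFun_comm {J : HilbertSchmidtExtension H K}
    [MeasurableSpace K] [BorelSpace K] {a b : ℝ} (ha : 0 ≤ a) (hb : 0 ≤ b) {μ ν : Measure K}
    (hμ : J.IsGaussian a μ) (hν : J.IsGaussian b ν) :
    ∫ η, J.extend (charFun μ) η ∂ν = ∫ φ, J.extend (charFun ν) φ ∂μ := by
  have := J.separableSpace
  have := hμ.isProbabilityMeasure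
  have := hν.isProbabilityMeasure
  obtain ⟨s, hs, hs_dense⟩ := TopologicalSpace.exists_countable_dense K
  have : Countable s := hs.to_subtype
  let G : Finset s → Finset K := Finset.map (.subtype _)
  have hG : Monotone G := fun _ _ => Finset.map_subset_map.mpr
  have hdense : Dense (⋃ F, (G F : Set K)) :=
    hs_dense.mono fun y hy => mem_iUnion.mpr ⟨{⟨y, hy⟩}, by simp [G]⟩
  refine tendsto_nhds_unique (hμ.tendsto_integral_charFun_truncate hG hdense ha ν) ?_
  simpa only [J.integral_charFun_truncate_comm μ ν] using
    hν.tendsto_integral_charFun_truncate hG hdense hb μ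

end HilbertSchmidtExtension

end TwistedForms

theorem mainTheorem1_general {H H' K K' : Type*}
    [NormedAddCommGroup H] [InnerProductSpace ℝ H] [CompleteSpace H]
    [NormedAddCommGroup H'] [InnerProductSpace ℝ H'] [CompleteSpace H']
    [NormedAddCommGroup K] [InnerProductSpace ℝ K] [CompleteSpace K]
    [MeasurableSpace K] [BorelSpace K]
    [NormedAddCommGroup K'] [InnerProductSpace ℝ K'] [CompleteSpace K']
    [MeasurableSpace K'] [BorelSpace K']
    (J : TwistedForms.HilbertSchmidtExtension H K)
    (J' : TwistedForms.HilbertSchmidtExtension H' K')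
    (P : H →L[ℝ] H') (hP : ∀ ξ, ‖P.adjoint ξ‖ = ‖ξ‖)
    (Q : K →L[ℝ] K') (hQ : ∀ ξ, Q (J.incl ξ) = J'.incl (P ξ))
    {a b : ℝ} (ha : 0 ≤ a) (hb : 0 ≤ b)
    (μ : Measure K) (hμ : J.IsGaussian a μ) (μ' : Measure K') (hμ' : J'.IsGaussian b μ') :
    let χ : K' → ℂ := fun y => charFun μ (ContinuousLinearMap.adjoint Q y)
    let χ' : K' → ℂ := fun y => charFun μ' y
    (∀ F : Finset K',
      Integrable (fun η => χ (J'.truncate F η)) μ' ∧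
      Integrable (fun α => χ' (J'.truncate F (Q α))) μ ∧
      ∫ η, χ (J'.truncate F η) ∂μ' = ∫ α, χ' (J'.truncate F (Q α)) ∂μ) ∧
    (∀ η : K', Tendsto (fun F : Finset K' => χ (J'.truncate F η)) atTop (𝓝 (J'.extend χ η))) ∧
    (∀ η : K', Tendsto (fun F : Finset K' => χ' (J'.truncate F η)) atTop (𝓝 (J'.extend χ' η))) ∧
    Integrable (fun η => J'.extend χ η) μ' ∧
    Integrable (fun α => J'.extend χ' (Q α)) μ ∧
    ∫ η, J'.extend χ η ∂μ' = ∫ α, J'.extend χ' (Q α) ∂μ := by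
  intro χ χ'
  have := J'.separableSpace
  have := UniformSpace.secondCountable_of_separable K'
  have := hμ.isProbabilityMeasure
  have := hμ'.isProbabilityMeasure
  have hν : J'.IsGaussian a (μ.map Q) := hμ.map hP hQ
  have := hν.isProbabilityMeasure
  have hχ : χ = charFun (μ.map Q) :=
    funext fun y => (TwistedForms.charFun_map_continuousLinearMap Q μ y).symm
  have hQ_meas : Measurable Q := by fun_prop
  have hint (F : Finset K') : Integrable (fun η => χ' (J'.truncate F η)) (μ.map Q) :=
    TwistedForms.integrable_charFun_comp _ _ (J'.continuous_truncate F).measurable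
  have hint_extend : Integrable (J'.extend χ') (μ.map Q) := hμ'.integrable_extend_charFun hb _
  rw [hχ]
  refine ⟨fun F => ⟨TwistedForms.integrable_charFun_comp _ _ (J'.continuous_truncate F).measurable,
    (hint F).comp_measurable hQ_meas, ?_⟩, fun η => ?_, fun η => ?_,
    hν.integrable_extend_charFun ha μ', hint_extend.comp_measurable hQ_meas, ?_⟩
  · rw [J'.integral_charFun_truncate_comm,
      integral_map hQ_meas.aemeasurable (hint F).aestronglyMeasurable]
  · rw [hν.extend_charFun ha]
    exact hν.tendsto_charFun_truncate_atTop ha η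
  · rw [hμ'.extend_charFun hb]
    exact hμ'.tendsto_charFun_truncate_atTop hb η
  · rw [hν.integral_extend_charFun_comm ha hb hμ',
      integral_map hQ_meas.aemeasurable hint_extend.aestronglyMeasurable]

theorem mainTheorem1 {n : ℕ} {M : Type*} [TopologicalSpace M] [T2Space M] [CompactSpace M]
    [PathConnectedSpace M] [ChartedSpace (EuclideanSpace ℝ (Fin n)) M] [IsManifold (𝓡 n) ∞ M]
    [RiemannianBundle (fun x : M => TangentSpace (𝓡 n) x)]
    [IsContMDiffRiemannianBundle (𝓡 n) ∞ (EuclideanSpace ℝ (Fin n))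
      (fun x : M => TangentSpace (𝓡 n) x)]
    [MeasurableSpace M] [BorelSpace M]
    {V : Type*} [NormedAddCommGroup V] [InnerProductSpace ℝ V] {x₀ : M}
    (ρ : FundamentalGroup M x₀ →* (V ≃ₗᵢ[ℝ] V)) (hρ : TwistedForms.IsAcyclic n ρ)
    (k : ℕ) (hk : k ≤ n) (a b : ℝ) (ha : 0 < a) (hb : 0 < b)
    {K : Type*} [NormedAddCommGroup K] [InnerProductSpace ℝ K] [CompleteSpace K]
    [MeasurableSpace K] [BorelSpace K]
    {K' : Type*} [NormedAddCommGroup K'] [InnerProductSpace ℝ K'] [CompleteSpace K']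
    [MeasurableSpace K'] [BorelSpace K']
    (J : TwistedForms.HilbertSchmidtExtension (TwistedForms.L2Forms n ρ k) K)
    (J' : TwistedForms.HilbertSchmidtExtension (TwistedForms.L2Exact n ρ k) K')
    (Q : K →L[ℝ] K')
    (hQ : ∀ ξ : TwistedForms.L2Forms n ρ k,
      Q (J.incl ξ) = J'.incl (TwistedForms.exactPart n ρ k ξ))
    (μ : Measure K) (hμ : J.IsGaussian a μ) (μ' : Measure K') (hμ' : J'.IsGaussian b μ') :
    let χ : K' → ℂ := fun y => charFun μ (ContinuousLinearMap.adjoint Q y)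
    let χ' : K' → ℂ := fun y => charFun μ' y
    (∀ F : Finset K',
      Integrable (fun η => χ (J'.truncate F η)) μ' ∧
      Integrable (fun α => χ' (J'.truncate F (Q α))) μ ∧
      ∫ η, χ (J'.truncate F η) ∂μ' = ∫ α, χ' (J'.truncate F (Q α)) ∂μ) ∧
    (∀ η : K', Tendsto (fun F : Finset K' => χ (J'.truncate F η)) atTop (𝓝 (J'.extend χ η))) ∧
    (∀ η : K', Tendsto (fun F : Finset K' => χ' (J'.truncate F η)) atTop (𝓝 (J'.extend χ' η))) ∧
    Integrable (fun η => J'.extend χ η) μ' ∧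
    Integrable (fun α => J'.extend χ' (Q α)) μ ∧
    ∫ η, J'.extend χ η ∂μ' = ∫ α, J'.extend χ' (Q α) ∂μ := by
  exact mainTheorem1_general J J' (TwistedForms.exactPart n ρ k)
    (fun ξ => by rw [TwistedForms.exactPart, Submodule.adjoint_orthogonalProjectionOnto]; rfl)
    Q hQ ha.le hb.le μ hμ μ' hμ'
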